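/- **Threshold Direct Product Theorem.** For $X\subseteq\{0,1\}^d$ and a relation assigning to every $x\in X$ a set $A(x)$ of correct outputs, let $\mathrm{R}_\gamma(A)$ denote its worst-case randomized query complexity for success probability $\gamma$: the minimum, over all randomized algorithms (probability distributions over deterministic decision trees querying bits of the input) that on every input $x\in X$ output an element of $A(x)$ with probability at least $\gamma$, of the maximum number of queries made over all inputs $x\in X$ and all decision trees in the support of the algorithm. For a possibly partial Boolean function $f\colon X\to\{0,1\}$ write $\mathrm{R}_\gamma(f)$ for the case $A(x)=\{f(x)\}$, and $\mathrm{R}(f)=\mathrm{R}_{2/3}(f)$. For integers $n\ge 1$ and $k\le n$ let $\mathrm{Thr}^n_k\circ f$ be the relation that assigns to $(x^{(1)},\dots,x^{(n)})\in X^n$ the set of all $z\in\{0,1\}^n$ with $|\{i\in[n] : z_i=f(x^{(i)})\}|\ge k$. There exist universal constants $c\in(\tfrac12,1)$ and $C>0$ such that for every $m$, every (possibly partial) function $f\colon X\to\{0,1\}$ with $X\subseteq\{0,1\}^m$, all integers $n, k$ with $\tfrac n2<k\le n$, and every $\gamma\in[c,1)$, if $$\tau_{n,k}=\log_2\left(\frac{2^n}{\sum_{i=0}^{n-k}\binom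 ni}\right),$$ then $$\mathrm{R}_{\gamma^{\tau_{n,k}}}\left(\mathrm{Thr}^n_k\circ f\right)\ \ge\ C\,\tau_{n,k}\,\mathrm{R}(f).$$ -/

import Mathlib

/-- A deterministic decision tree reading input bits indexed by `ι` and producing an output in `O`.
The internal node `query i t₀ t₁` reads bit `i` and continues in `t₀` if it is `0`, in `t₁` if it
is `1`. -/
inductive DecisionTree (ι O : Type) : Type
  | leaf (o : O) : DecisionTree ι O
  | query (i : ι) (t₀ t₁ : DecisionTree ι O) : DecisionTree ι O

namespace DecisionTree

variable {ι O : Type}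

/-- The label of the leaf reached by the input `x`. -/
def eval (x : ι → Bool) : DecisionTree ι O → O
  | leaf o => o
  | query i t₀ t₁ => if x i then t₁.eval x else t₀.eval x

/-- The depth of the leaf reached by the input `x`, that is, the number of queries made on `x`. -/
def cost (x : ι → Bool) : DecisionTree ι O → ℕ
  | leaf _ => 0
  | query i t₀ t₁ => (if x i then t₁.cost x else t₀.cost x) + 1

end DecisionTree

/-- A randomized algorithm is a probability distribution over deterministic decision trees. (There
are only countably many decision trees over finite `ι` and `O`.) -/
abbrev RandomizedAlgorithm (ι O : Type) : Type := PMF (DecisionTree ι O)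

namespace RandomizedAlgorithm

variable {ι O : Type}

/-- The probability, over the internal randomness of `R`, that the output of `R` on input `x` lies
in the set `A` of correct outputs. -/
noncomputable def successProb (R : RandomizedAlgorithm ι O) (x : ι → Bool) (A : Set O) : ℝ :=
  (R.toOuterMeasure {D | D.eval x ∈ A}).toReal

/-- The worst-case cost of `R` on the domain `X`: the maximum of the number of queries, over the
inputs in `X` and over the trees in the support of `R`. It is `⊤` if that number is unbounded. -/
noncomputable def cost (R : RandomizedAlgorithm ι O) (X : Set (ι → Bool)) : ℕ∞ :=
  ⨆ x ∈ X, ⨆ D ∈ R.support, (D.cost x : ℕ∞)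

/-- `R` computes the relation `rel` with success probability at least `γ` on every input of the
domain. -/
def Computes (R : RandomizedAlgorithm ι O) {X : Set (ι → Bool)} (rel : X → Set O) (γ : ℝ) : Prop :=
  ∀ x : X, γ ≤ R.successProb x (rel x)

end RandomizedAlgorithm

/-- The worst-case randomized query complexity, for success probability `γ`, of a relation with
domain `X ⊆ {0,1}^ι`: the least worst-case cost of a randomized algorithm that computes it with
success probability at least `γ` on every input in `X`. -/
noncomputable def randQueryComplexity {ι O : Type} {X : Set (ι → Bool)} (rel : X → Set O)
    (γ : ℝ) : ℕ :=
  sInf {d : ℕ | ∃ R : RandomizedAlgorithm ι O, R.Computes rel γ ∧ R.cost X ≤ d}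

/-- Over finitely many input bits there is a decision tree for every function. -/
theorem DecisionTree.exists_eval_eq {ι O : Type} [Fintype ι] (g : (ι → Bool) → O) :
    ∃ D : DecisionTree ι O, ∀ x, D.eval x = g x ∧ D.cost x ≤ Fintype.card ι := by
  classical
  have key : ∀ (l : List ι) (g : (ι → Bool) → O),
      (∀ x y : ι → Bool, (∀ i ∈ l, x i = y i) → g x = g y) →
      ∃ D : DecisionTree ι O, ∀ x, D.eval x = g x ∧ D.cost x ≤ l.length := by
    intro l
    induction l with
    | nil =>
      intro g hg
      exact ⟨.leaf (g fun _ => false), fun x => ⟨hg _ _ (by simp), le_rfl⟩⟩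
    | cons i l ih =>
      intro g hg
      have h : ∀ b : Bool, ∃ D : DecisionTree ι O, ∀ x,
          D.eval x = g (Function.update x i b) ∧ D.cost x ≤ l.length := by
        intro b
        apply ih (fun x => g (Function.update x i b))
        intro x y hxy
        apply hg
        intro j hj
        by_cases hji : j = i
        · subst hji; simp
        · have hjl : j ∈ l := by simpa [hji] using hj
          simp [hji, hxy j hjl]
      obtain ⟨D₀, h₀⟩ := h false
      obtain ⟨D₁, h₁⟩ := h true
      refine ⟨.query i D₀ D₁, fun x => ?_⟩
      have hu : g (Function.update x i (x i)) = g x := by simp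
      cases hx : x i
      · rw [hx] at hu
        simp [DecisionTree.eval, DecisionTree.cost, hx, (h₀ x).1, hu, (h₀ x).2]
      · rw [hx] at hu
        simp [DecisionTree.eval, DecisionTree.cost, hx, (h₁ x).1, hu, (h₁ x).2]
  obtain ⟨D, hD⟩ := key Finset.univ.toList g
    (fun x y h => congrArg g (funext fun i => h i (by simp)))
  exact ⟨D, fun x => by simpa using hD x⟩

/-- The minimum in the definition of `randQueryComplexity` is attained whenever every input has a
correct output and `γ ≤ 1`; so it is then the minimum of a nonempty set. -/
theorem randQueryComplexity_attained {ι O : Type} [Fintype ι] [Nonempty O] {X : Set (ι → Bool)}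
    (rel : X → Set O) (hrel : ∀ x, (rel x).Nonempty) {γ : ℝ} (hγ : γ ≤ 1) :
    ∃ R : RandomizedAlgorithm ι O,
      R.Computes rel γ ∧ R.cost X ≤ (randQueryComplexity rel γ : ℕ∞) := by
  classical
  refine Nat.sInf_mem
    (s := {d : ℕ | ∃ R : RandomizedAlgorithm ι O, R.Computes rel γ ∧ R.cost X ≤ d})
    ⟨Fintype.card ι, ?_⟩
  choose o ho using hrel
  obtain ⟨D, hD⟩ := DecisionTree.exists_eval_eq
    (fun x : ι → Bool => if h : x ∈ X then o ⟨x, h⟩ else Classical.arbitrary O)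
  refine ⟨PMF.pure D, fun x => ?_, ?_⟩
  · have hmem : D.eval x.1 ∈ rel x := by
      rw [(hD x.1).1]
      simpa using ho x
    simpa [RandomizedAlgorithm.successProb, PMF.toOuterMeasure_pure_apply, hmem] using hγ
  · refine iSup₂_le fun x _ => iSup₂_le fun D' hD' => ?_
    have hDD : D' = D := by simpa using hD'
    subst hDD
    exact_mod_cast (hD x).2

/-- `R_γ(f)` for a partial Boolean function `f : X → {0,1}`, `X ⊆ {0,1}^ι`. -/
noncomputable def randComplexityOfFun {ι : Type} {X : Set (ι → Bool)} (f : X → Bool) (γ : ℝ) : ℕ :=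
  randQueryComplexity (fun x => {f x}) γ

/-- `X^n ⊆ {0,1}^{n × m}`: the `n`-tuples all of whose entries `x⁽ⁱ⁾ = (x (i, j))_j` lie in `X`. -/
def productDomain {m : ℕ} (X : Set (Fin m → Bool)) (n : ℕ) : Set (Fin n × Fin m → Bool) :=
  {x | ∀ i, (fun j => x (i, j)) ∈ X}

/-- The function `f^n : X^n → {0,1}^n`, `(x⁽¹⁾, …, x⁽ⁿ⁾) ↦ (f x⁽¹⁾, …, f x⁽ⁿ⁾)`. -/
def productFun {m : ℕ} {X : Set (Fin m → Bool)} (f : X → Bool) (n : ℕ) :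
    productDomain X n → (Fin n → Bool) :=
  fun x i => f ⟨fun j => x.1 (i, j), x.2 i⟩

/-- The `k`-of-`n` threshold relation: the vectors that agree with `y` in at least `k` places. -/
def Thr (n k : ℕ) (y : Fin n → Bool) : Set (Fin n → Bool) :=
  {z | k ≤ (Finset.univ.filter fun i => y i = z i).card}

/-- `τ_{n,k} = log₂ (2^n / ∑_{i=0}^{n-k} C(n,i))`, used for `k ≤ n`. -/
noncomputable def tau (n k : ℕ) : ℝ :=
  Real.logb 2 (2 ^ n / ∑ i ∈ Finset.range (n - k + 1), (n.choose i : ℝ))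

/-! Let a forecasting tree query bits, announce some `a ∈ [-1, 1]` for the sign `y` of `f(x)`, earn
`2ay - a²` and pay `β` per query. For `β = 263 / R(f)` no mixture of such trees has positive payoff
on every input. Otherwise one could repeat it and output the sign of the summed forecasts; an
exponential supermartingale bounds the error, and `f` is computed with fewer than `R(f)` queries
(`exists_errorVector_of_payoff`). Separating convex sets then gives a distribution `μ` on which
every tree has payoff at most `0` (`exists_hard_distribution`).

Now draw `n` independent inputs from `μ` and give each coordinate the potential "mass plus best
payoff", which starts at most `1`. A query touches one coordinate, and the product of the
potentials, summed over both answers, grows by a factor of at most `1 + β`. At a leaf this product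
dominates a normalised sum of squared probabilities over all label vectors, whereas only a fraction
`2^{-τ}` of the label vectors agrees with the output in `k` places. A weighted AM-GM inequality
bounds the success probability after `q` queries by `(1 + β)^q 2^{-τ/2}`
(`sum_prodWeight_accepted_le`, `sum_prodWeight_mem_Thr_le`). For `q < τ R(f) / 2630` this is below
`(9/10)^τ`. -/

/-! ### Depth and truncation of decision trees -/

namespace DecisionTree

variable {ι O : Type}

/-- The length of the longest path of the tree. -/
def depth : DecisionTree ι O → ℕ
  | leaf _ => 0
  | query _ t₀ t₁ => max t₀.depth t₁.depth + 1

/-- Cut the tree at depth `d`, with output `o` on the paths that were cut. -/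
def truncate (o : O) : ℕ → DecisionTree ι O → DecisionTree ι O
  | _, leaf a => leaf a
  | 0, query _ _ _ => leaf o
  | d + 1, query i t₀ t₁ => query i (truncate o d t₀) (truncate o d t₁)

theorem depth_truncate_le (o : O) (d : ℕ) (D : DecisionTree ι O) : (D.truncate o d).depth ≤ d := by
  induction d generalizing D with
  | zero => cases D <;> simp [truncate, depth]
  | succ d ih =>
    cases D with
    | leaf a => simp [truncate, depth]
    | query i t₀ t₁ =>
      have := ih t₀
      have := ih t₁
      simp only [truncate, depth]
      omega

theorem truncate_spec (o : O) (d : ℕ) (D : DecisionTree ι O) (x : ι → Bool) :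
    ((D.truncate o d).eval x = D.eval x ∧ (D.truncate o d).cost x = D.cost x) ∨
      (d < D.cost x ∧ (D.truncate o d).eval x = o ∧ (D.truncate o d).cost x = d) := by
  induction d generalizing D with
  | zero => cases D <;> simp [truncate, cost, eval]
  | succ d ih =>
    cases D with
    | leaf a => simp [truncate]
    | query i t₀ t₁ =>
      have h₀ := ih t₀
      have h₁ := ih t₁
      cases hx : x i <;> simpa [truncate, cost, eval, hx]

end DecisionTree

/-! ### Quadratic scores of forecasting trees -/

/-- The sign `±1` of a Boolean value. -/
def boolSign (b : Bool) : ℝ := if b then 1 else -1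

theorem boolSign_sq (b : Bool) : boolSign b ^ 2 = 1 := by cases b <;> norm_num [boolSign]

/-- The payoff of a forecasting tree: the quadratic score of the forecast for the sign `y`, minus
`β` for each query. -/
noncomputable def forecastPayoff {ι : Type} (β : ℝ) (D : DecisionTree ι (Set.Icc (-1 : ℝ) 1))
    (x : ι → Bool) (y : ℝ) : ℝ :=
  2 * (D.eval x).1 * y - (D.eval x).1 ^ 2 - β * D.cost x

theorem forecastPayoff_le {ι : Type} {β : ℝ} (hβ : 0 ≤ β)
    (D : DecisionTree ι (Set.Icc (-1 : ℝ) 1)) (x : ι → Bool) {y : ℝ} (hy : y ^ 2 = 1) :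
    forecastPayoff β D x y ≤ 1 := by
  have h : 0 ≤ β * D.cost x := by positivity
  unfold forecastPayoff
  nlinarith [sq_nonneg ((D.eval x).1 - y)]

/-- The forecast `0`. -/
def zeroForecast : Set.Icc (-1 : ℝ) 1 := ⟨0, by norm_num, by norm_num⟩

/-- A path that gets cut makes more than `2 / β` queries, so its payoff was below `1 - 2 = -1`.
After the cut it scores `0` and, at the halved price, pays at most `(β / 2)(2 / β) = 1`. -/
theorem forecastPayoff_le_truncate {ι : Type} {β : ℝ} (hβ : 0 < β)
    (D : DecisionTree ι (Set.Icc (-1 : ℝ) 1)) (x : ι → Bool) {y : ℝ} (hy : y ^ 2 = 1) :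
    forecastPayoff β D x y ≤ forecastPayoff (β / 2) (D.truncate zeroForecast ⌊2 / β⌋₊) x y := by
  unfold forecastPayoff
  rcases D.truncate_spec zeroForecast ⌊2 / β⌋₊ x with ⟨h₁, h₂⟩ | ⟨h₀, h₁, h₂⟩
  · rw [h₁, h₂]
    have h : 0 ≤ β * D.cost x := by positivity
    linarith
  · rw [h₁, h₂]
    have h₃ : (⌊2 / β⌋₊ : ℝ) + 1 ≤ D.cost x := by exact_mod_cast h₀
    have h₄ : 2 / β < ⌊2 / β⌋₊ + 1 := Nat.lt_floor_add_one _
    have h₅ : (⌊2 / β⌋₊ : ℝ) ≤ 2 / β := Nat.floor_le (by positivity)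
    rw [div_lt_iff₀ hβ] at h₄
    rw [le_div_iff₀ hβ] at h₅
    have h₆ := mul_le_mul_of_nonneg_left h₃ hβ.le
    simp only [zeroForecast]
    nlinarith [sq_nonneg ((D.eval x).1 - y)]

/-! ### Randomized algorithms as convex combinations of error vectors -/

section ErrorVectors

variable {ι : Type} {X : Set (ι → Bool)}

/-- The error indicators, as vectors indexed by the domain, of the trees of cost at most `r`. -/
def errorVectors (f : X → Bool) (r : ℕ) : Set (X → ℝ) :=
  {v | ∃ D : DecisionTree ι Bool, (∀ x, D.cost x ≤ r) ∧
    v = fun x : X => if D.eval x = f x then 0 else 1}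

/-- Querying a bit acts linearly on the pair of error vectors of the two subtrees, and the convex
hull of a product is the product of the hulls. -/
theorem mix_query_mem_convexHull_errorVectors {f : X → Bool} {r : ℕ} (i : ι) {u₀ u₁ : X → ℝ}
    (h₀ : u₀ ∈ convexHull ℝ (errorVectors f r)) (h₁ : u₁ ∈ convexHull ℝ (errorVectors f r)) :
    (fun x : X => if x.1 i then u₁ x else u₀ x) ∈ convexHull ℝ (errorVectors f (r + 1)) := by
  let L : (X → ℝ) × (X → ℝ) →ₗ[ℝ] (X → ℝ) :=
    { toFun := fun p x => if x.1 i then p.2 x else p.1 x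
      map_add' := by
        intro p q; ext x
        by_cases hx : x.1 i <;> simp [hx]
      map_smul' := by
        intro a p; ext x
        by_cases hx : x.1 i <;> simp [hx] }
  have hmem : (u₀, u₁) ∈ convexHull ℝ (errorVectors f r ×ˢ errorVectors f r) := by
    rw [convexHull_prod]
    exact ⟨h₀, h₁⟩
  have himage : L '' (errorVectors f r ×ˢ errorVectors f r) ⊆ errorVectors f (r + 1) := by
    rintro _ ⟨⟨_, _⟩, ⟨⟨D₀, hD₀, rfl⟩, ⟨D₁, hD₁, rfl⟩⟩, rfl⟩
    refine ⟨.query i D₀ D₁, fun x => ?_, ?_⟩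
    · cases hx : x i
      · simpa [DecisionTree.cost, hx] using hD₀ x
      · simpa [DecisionTree.cost, hx] using hD₁ x
    · ext x
      by_cases hx : x.1 i <;> simp [L, DecisionTree.eval, hx]
  apply convexHull_mono himage
  rw [← L.image_convexHull]
  exact ⟨_, hmem, rfl⟩

/-- This makes sequential composition legitimate: the continuation may be randomized and may depend
on the output of `D` and on the number of queries spent, which is deducted from the budget. -/
theorem graft_mem_convexHull_errorVectors {O : Type} {f : X → Bool} (D : DecisionTree ι O)
    {d r : ℕ} (hD : D.depth ≤ d) (hdr : d ≤ r) (u : O → ℕ → X → ℝ)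
    (hu : ∀ a, ∀ q ≤ d, u a q ∈ convexHull ℝ (errorVectors f (r - q))) :
    (fun x : X => u (D.eval x) (D.cost x) x) ∈ convexHull ℝ (errorVectors f r) := by
  induction D generalizing d r u with
  | leaf a => simpa [DecisionTree.eval, DecisionTree.cost] using hu a 0 (Nat.zero_le d)
  | query i t₀ t₁ ih₀ ih₁ =>
    simp only [DecisionTree.depth] at hD
    obtain ⟨d, rfl⟩ : ∃ e, d = e + 1 := ⟨d - 1, by omega⟩
    obtain ⟨r, rfl⟩ : ∃ e, r = e + 1 := ⟨r - 1, by omega⟩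
    have hu' : ∀ a, ∀ q ≤ d, u a (q + 1) ∈ convexHull ℝ (errorVectors f (r - q)) := by
      intro a q hq
      simpa using hu a (q + 1) (by omega)
    have h₀ := ih₀ (d := d) (r := r) (by omega) (by omega) (fun a q => u a (q + 1)) hu'
    have h₁ := ih₁ (d := d) (r := r) (by omega) (by omega) (fun a q => u a (q + 1)) hu'
    convert mix_query_mem_convexHull_errorVectors i h₀ h₁ using 1
    ext x
    by_cases hx : x.1 i <;> simp [DecisionTree.eval, DecisionTree.cost, hx]

theorem exists_randomizedAlgorithm_of_mem_convexHull {f : X → Bool} {r : ℕ} {v : X → ℝ}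
    (hv : v ∈ convexHull ℝ (errorVectors f r)) :
    ∃ R : RandomizedAlgorithm ι Bool,
      (∀ x : X, R.successProb x {f x} = 1 - v x) ∧ R.cost X ≤ r := by
  classical
  rw [mem_convexHull_iff_exists_fintype] at hv
  obtain ⟨J, _, w, z, hw, hw1, hz, rfl⟩ := hv
  choose D hD hzD using hz
  have hsum : ∑ j, ENNReal.ofReal (w j) = 1 := by
    rw [← ENNReal.ofReal_sum_of_nonneg (fun j _ => hw j), hw1, ENNReal.ofReal_one]
  refine ⟨(PMF.ofFintype (fun j => ENNReal.ofReal (w j)) hsum).map D, fun x => ?_, ?_⟩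
  · have h : 1 - (∑ j, w j • z j) x = ∑ j, if (D j).eval x = f x then w j else 0 := by
      rw [← hw1, Finset.sum_apply, ← Finset.sum_sub_distrib]
      refine Finset.sum_congr rfl fun j _ => ?_
      rw [hzD j]
      by_cases hj : (D j).eval x = f x <;> simp [hj]
    rw [h, RandomizedAlgorithm.successProb, PMF.toOuterMeasure_map_apply,
      PMF.toOuterMeasure_apply_fintype, ENNReal.toReal_sum]
    · refine Finset.sum_congr rfl fun j _ => ?_
      by_cases hj : (D j).eval x = f x <;> simp [hj, hw j]
    · intro j _
      by_cases hj : (D j).eval x = f x <;> simp [hj]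
  · refine iSup₂_le fun x _ => iSup₂_le fun D' hD' => ?_
    rw [PMF.mem_support_map_iff] at hD'
    obtain ⟨j, -, rfl⟩ := hD'
    exact_mod_cast hD j x

theorem randComplexityOfFun_le_of_mem_convexHull {f : X → Bool} {r : ℕ} {v : X → ℝ}
    (hv : v ∈ convexHull ℝ (errorVectors f r)) (hv3 : ∀ x, v x ≤ 1 / 3) :
    randComplexityOfFun f (2 / 3) ≤ r := by
  obtain ⟨R, hR, hcost⟩ := exists_randomizedAlgorithm_of_mem_convexHull hv
  refine Nat.sInf_le ⟨R, fun x => ?_, hcost⟩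
  rw [hR x]
  linarith [hv3 x]

end ErrorVectors

/-! ### Amplification of a positive payoff to an algorithm for `f` -/

theorem exp_le_one_add_add_sq {t : ℝ} (ht : |t| ≤ 1) : Real.exp t ≤ 1 + t + t ^ 2 := by
  have := (abs_le.mp (Real.abs_exp_sub_one_sub_id_le ht)).2
  linarith

/-- The exponential weight of one run of a forecasting tree is dominated by a linear function. -/
theorem exp_forecast_le {a h y : ℝ} (ha : |a| ≤ 1) (hy : y ^ 2 = 1) (hah : a ^ 2 ≤ h)
    (hh : h ≤ 3) :
    Real.exp (-(a * y) / 8 + h / 64) ≤ 1 - (2 * a * y - h) / 16 := by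
  have hy' : |y| = 1 := by
    rw [← Real.sqrt_sq_eq_abs, hy, Real.sqrt_one]
  have hay : |a * y| ≤ 1 := by rw [abs_mul, hy', mul_one]; exact ha
  obtain ⟨h₁, h₂⟩ := abs_le.mp hay
  have hh0 : 0 ≤ h := (sq_nonneg a).trans hah
  have ht : |-(a * y) / 8 + h / 64| ≤ 1 := by
    rw [abs_le]; constructor <;> linarith
  have hsq : (a * y) ^ 2 ≤ h := by rw [mul_pow, hy, mul_one]; exact hah
  have hhsq : h ^ 2 ≤ 3 * h := by nlinarith
  refine (exp_le_one_add_add_sq ht).trans ?_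
  nlinarith [sq_nonneg (a * y + h / 8)]

section Amplification

variable {ι : Type} {X : Set (ι → Bool)}

/-- The payoff vectors, indexed by the domain, of the forecasting trees of depth at most `d`. -/
def payoffVectors (f : X → Bool) (β : ℝ) (d : ℕ) : Set (X → ℝ) :=
  {v | ∃ D : DecisionTree ι (Set.Icc (-1 : ℝ) 1), D.depth ≤ d ∧
    v = fun x : X => forecastPayoff β D x (boolSign (f x))}

theorem DecisionTree.cost_le_depth {O : Type} (D : DecisionTree ι O) (x : ι → Bool) :
    D.cost x ≤ D.depth := by
  induction D with
  | leaf a => simp [cost]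
  | query i t₀ t₁ ih₀ ih₁ =>
    simp only [cost, depth]
    cases x i
    · simpa using Or.inl ih₀
    · simpa using Or.inr ih₁

/-- Repeating a mixture of forecasting trees whose payoff is at least `ε` on every input, until the
accumulated charge `A` reaches `B`, and outputting the sign of the sum `s` of the forecasts. -/
theorem exists_errorVector_of_payoff {f : X → Bool} {β ε B : ℝ} {d : ℕ} (hβ : 0 < β)
    (hd : β * d ≤ 1) (hε : 0 < ε) (hε1 : ε ≤ 1) {v : X → ℝ}
    (hv : v ∈ convexHull ℝ (payoffVectors f β d)) (hvε : ∀ x, ε ≤ v x) (N : ℕ) :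
    ∀ (s A : ℝ) (r : ℕ), B ≤ A + N * ε → B + 3 - A < β * (r + 1) →
      ∃ u ∈ convexHull ℝ (errorVectors f r),
        ∀ x, u x ≤ Real.exp (-(s * boolSign (f x)) / 8 + (A - B) / 64) := by
  rw [mem_convexHull_iff_exists_fintype] at hv
  obtain ⟨J, _, w, z, hw, hw1, hz, rfl⟩ := hv
  choose D hD hzD using hz
  -- The stopping rule: a wrong output means that `s` and the true sign do not agree, so with `B ≤
  -- A` the exponent is nonnegative and the bound is at least `1`.
  have key : ∀ (s A : ℝ) (r : ℕ), B ≤ A →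
      ∃ u ∈ convexHull ℝ (errorVectors f r),
        ∀ x, u x ≤ Real.exp (-(s * boolSign (f x)) / 8 + (A - B) / 64) := by
    intro s A r hA
    refine ⟨_, subset_convexHull _ _ ⟨.leaf (decide (0 ≤ s)), fun x => Nat.zero_le _, rfl⟩,
      fun x => ?_⟩
    change (if decide (0 ≤ s) = f x then (0 : ℝ) else 1) ≤ _
    split_ifs with h
    · positivity
    · rw [Real.one_le_exp_iff]
      cases hx : f x
      · have : 0 ≤ s := by simpa [hx] using h
        simp only [boolSign]
        norm_num
        linarith
      · have : s < 0 := by simpa [hx] using h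
        simp only [boolSign]
        norm_num
        linarith
  induction N with
  | zero =>
    intro s A r hA _
    exact key s A r (by simpa using hA)
  | succ N ih =>
    intro s A r hA hr
    by_cases hBA : B ≤ A
    · exact key s A r hBA
    push Not at hBA
    push_cast at hA
    have hβr : 3 < β * (r + 1) := by linarith
    have hdr : d ≤ r := by
      by_contra! hlt
      have : (r : ℝ) + 1 ≤ d := by exact_mod_cast hlt
      have := mul_le_mul_of_nonneg_left this hβ.le
      linarith
    -- One run is charged `a² + βq + ε ≤ 3`. The term `a²` pays for the variance, `βq` for the
    -- queries, and `ε` bounds the number of runs without entering the query budget.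
    have hu : ∀ (a : Set.Icc (-1 : ℝ) 1) (q : ℕ), ∃ u : X → ℝ, q ≤ d →
        u ∈ convexHull ℝ (errorVectors f (r - q)) ∧
        ∀ x, u x ≤ Real.exp (-((s + a.1) * boolSign (f x)) / 8 +
          (A + (a.1 ^ 2 + β * q + ε) - B) / 64) := by
      intro a q
      by_cases hq : q ≤ d
      · have hcast : ((r - q : ℕ) : ℝ) = r - q := Nat.cast_sub (hq.trans hdr)
        have h₁ : 0 ≤ β * q := by positivity
        obtain ⟨u, hu, hux⟩ := ih (s + a.1) (A + (a.1 ^ 2 + β * q + ε)) (r - q)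
          (by nlinarith [sq_nonneg a.1]) (by rw [hcast]; nlinarith [sq_nonneg a.1])
        exact ⟨u, fun _ => ⟨hu, hux⟩⟩
      · exact ⟨0, fun h => absurd h hq⟩
    choose u hu using hu
    refine ⟨∑ j, w j • fun x : X => u ((D j).eval x) ((D j).cost x) x,
      (convex_convexHull ℝ _).sum_mem (fun j _ => hw j) hw1 fun j _ =>
        graft_mem_convexHull_errorVectors (D j) (hD j) hdr u fun a q hq => (hu a q hq).1,
      fun x => ?_⟩
    set y := boolSign (f x) with hy
    have hterm : ∀ j, u ((D j).eval x) ((D j).cost x) x ≤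
        Real.exp (-(s * y) / 8 + (A - B) / 64) *
          (1 - (forecastPayoff β (D j) x y - ε) / 16) := by
      intro j
      set a := (D j).eval x with ha
      set q := (D j).cost x with hq
      have hqd : q ≤ d := ((D j).cost_le_depth x).trans (hD j)
      have hqd' : β * q ≤ β * d := mul_le_mul_of_nonneg_left (by exact_mod_cast hqd) hβ.le
      have hq0 : 0 ≤ β * q := by positivity
      have ha1 : |a.1| ≤ 1 := abs_le.mpr a.2
      have ha2 : a.1 ^ 2 ≤ 1 := by rw [← sq_abs]; exact pow_le_one₀ (abs_nonneg _) ha1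
      have hexp := exp_forecast_le ha1 (boolSign_sq (f x))
        (show a.1 ^ 2 ≤ a.1 ^ 2 + β * q + ε by linarith) (by linarith)
      refine ((hu a q hqd).2 x).trans ?_
      have hsplit : -((s + a.1) * y) / 8 + (A + (a.1 ^ 2 + β * q + ε) - B) / 64 =
          (-(s * y) / 8 + (A - B) / 64) + (-(a.1 * y) / 8 + (a.1 ^ 2 + β * q + ε) / 64) := by ring
      rw [hsplit, Real.exp_add]
      refine mul_le_mul_of_nonneg_left (hexp.trans (le_of_eq ?_)) (Real.exp_pos _).le
      simp only [forecastPayoff, ← ha, ← hq, ← hy]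
      ring
    -- The mean payoff covers the `ε` in the charge, so one run does not increase the exponential
    -- weight on average.
    have hpay : ε ≤ ∑ j, w j * forecastPayoff β (D j) x y := by
      simpa [Finset.sum_apply, hzD] using hvε x
    calc (∑ j, w j • fun x : X => u ((D j).eval x) ((D j).cost x) x) x
        = ∑ j, w j * u ((D j).eval x) ((D j).cost x) x := by simp [Finset.sum_apply]
      _ ≤ ∑ j, w j * (Real.exp (-(s * y) / 8 + (A - B) / 64) *
            (1 - (forecastPayoff β (D j) x y - ε) / 16)) :=
          Finset.sum_le_sum fun j _ => mul_le_mul_of_nonneg_left (hterm j) (hw j)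
      _ = Real.exp (-(s * y) / 8 + (A - B) / 64) *
            ((∑ j, w j) * (1 + ε / 16) - (∑ j, w j * forecastPayoff β (D j) x y) / 16) := by
          rw [Finset.sum_mul, Finset.sum_div, ← Finset.sum_sub_distrib, Finset.mul_sum]
          exact Finset.sum_congr rfl fun j _ => by ring
      _ ≤ Real.exp (-(s * y) / 8 + (A - B) / 64) * 1 := by
          refine mul_le_mul_of_nonneg_left ?_ (Real.exp_pos _).le
          rw [hw1]; linarith
      _ = _ := mul_one _

theorem exp_neg_two_le_third : Real.exp (-2) ≤ 1 / 3 := by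
  rw [Real.exp_neg, inv_eq_one_div]
  exact one_div_le_one_div_of_le (by norm_num) (by linarith [Real.add_one_le_exp (2 : ℝ)])

/-- The threshold `B = 128` makes the error at most `exp (-128 / 64) ≤ 1 / 3`; `131` adds the
largest overshoot `3` of the last run. -/
theorem randComplexityOfFun_le_of_payoff {f : X → Bool} {β ε : ℝ} {d r : ℕ} (hβ : 0 < β)
    (hd : β * d ≤ 1) (hε : 0 < ε) {v : X → ℝ}
    (hv : v ∈ convexHull ℝ (payoffVectors f β d)) (hvε : ∀ x, ε ≤ v x) (hr : 131 < β * (r + 1)) :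
    randComplexityOfFun f (2 / 3) ≤ r := by
  have hδ : 0 < min ε 1 := lt_min hε one_pos
  obtain ⟨N, hN⟩ := exists_nat_ge (128 / min ε 1)
  rw [div_le_iff₀ hδ] at hN
  obtain ⟨u, hu, hux⟩ := exists_errorVector_of_payoff (B := 128) hβ hd hδ (min_le_right _ _) hv
    (fun x => (min_le_left _ _).trans (hvε x)) N 0 0 r (by linarith) (by linarith)
  refine randComplexityOfFun_le_of_mem_convexHull hu fun x => (hux x).trans ?_
  refine le_trans (le_of_eq ?_) exp_neg_two_le_third
  congr 1; norm_num

end Amplification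

/-! ### A hard distribution by convex separation -/

section HardDistribution

/-- A convex set of vectors that contains no positive vector is nonpositive on average for some
probability distribution on the coordinates. -/
theorem exists_weights_nonpos_of_convex {κ : Type*} [Fintype κ] {K : Set (κ → ℝ)}
    (hK : Convex ℝ K) (hne : K.Nonempty) (hpos : ∀ v ∈ K, ¬ ∀ x, 0 < v x) :
    ∃ μ : κ → ℝ, (∀ x, 0 ≤ μ x) ∧ ∑ x, μ x = 1 ∧ ∀ v ∈ K, ∑ x, μ x * v x ≤ 0 := by
  classical
  let P : Set (κ → ℝ) := Set.univ.pi fun _ => Set.Ioi 0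
  have hPc : Convex ℝ P := convex_pi fun _ _ => convex_Ioi 0
  have hPo : IsOpen P := isOpen_set_pi Set.finite_univ fun _ _ => isOpen_Ioi
  have hdisj : Disjoint P K := Set.disjoint_left.mpr fun v hvP hvK =>
    hpos v hvK fun x => hvP x (Set.mem_univ x)
  obtain ⟨g, u, hgP, hgK⟩ := geometric_hahn_banach_open hPc hPo hK hdisj
  have hrep : ∀ v : κ → ℝ, g v = ∑ x, v x * g (Pi.single x 1) := by
    intro v
    conv_lhs => rw [pi_eq_sum_univ' v]
    simp [map_sum]
  -- `P` is a cone, so a positive value of `g` could be scaled beyond `u`.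
  have hu : ∀ v ∈ P, g v ≤ 0 := by
    intro v hv
    by_contra! h
    have hc : 0 < |u| / g v + 1 := by positivity
    have := hgP ((|u| / g v + 1) • v) fun x hx => mul_pos hc (hv x hx)
    rw [map_smul, smul_eq_mul, add_mul, div_mul_cancel₀ _ h.ne'] at this
    linarith [le_abs_self u]
  -- The origin is a limit of points of `P`, where `g < u`.
  have hu0 : 0 ≤ u := by
    have hlim : Filter.Tendsto (fun t : ℝ => g (t • fun _ => (1 : ℝ))) (nhdsWithin 0 (Set.Ioi 0))
        (nhds 0) := by
      have : Continuous fun t : ℝ => g (t • fun _ => (1 : ℝ)) := by fun_prop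
      have h := (this.tendsto 0).mono_left (nhdsWithin_le_nhds (s := Set.Ioi 0))
      simpa using h
    refine le_of_tendsto hlim ?_
    filter_upwards [self_mem_nhdsWithin] with t ht
    refine (hgP _ fun x _ => ?_).le
    simpa using ht
  have hcoef : ∀ x, g (Pi.single x 1) ≤ 0 := by
    intro x
    have hlim : Filter.Tendsto (fun t : ℝ => g (Pi.single x 1 + t • fun _ => (1 : ℝ)))
        (nhdsWithin 0 (Set.Ioi 0)) (nhds (g (Pi.single x 1))) := by
      have : Continuous fun t : ℝ => g (Pi.single x 1 + t • fun _ => (1 : ℝ)) := by fun_prop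
      have h := (this.tendsto 0).mono_left (nhdsWithin_le_nhds (s := Set.Ioi 0))
      simpa using h
    refine le_of_tendsto hlim ?_
    filter_upwards [self_mem_nhdsWithin] with t ht
    refine hu _ fun z _ => ?_
    have ht' : 0 < t := ht
    by_cases hz : z = x
    · subst hz; simp; linarith
    · simpa [hz] using ht'
  have hM : 0 < ∑ x, -g (Pi.single x 1) := by
    refine lt_of_le_of_ne (Finset.sum_nonneg fun x _ => by linarith [hcoef x]) fun h => ?_
    rw [eq_comm, Finset.sum_eq_zero_iff_of_nonneg fun x _ => by linarith [hcoef x]] at h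
    have hz : ∀ v, g v = 0 := by
      intro v
      rw [hrep v]
      refine Finset.sum_eq_zero fun x hx => ?_
      have := h x hx
      rw [neg_eq_zero] at this
      rw [this, mul_zero]
    obtain ⟨b, hb⟩ := hne
    have h₁ := hgK b hb
    have h₂ := hgP (fun _ => 1) fun x _ => Set.mem_Ioi.mpr one_pos
    rw [hz] at h₁ h₂
    linarith
  refine ⟨fun x => -g (Pi.single x 1) / ∑ z, -g (Pi.single z 1),
    fun x => div_nonneg (by linarith [hcoef x]) hM.le, ?_, fun v hv => ?_⟩
  · rw [← Finset.sum_div, div_self hM.ne']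
  · have h : ∑ x, -g (Pi.single x 1) / (∑ z, -g (Pi.single z 1)) * v x =
        -g v / ∑ z, -g (Pi.single z 1) := by
      rw [hrep v, ← Finset.sum_neg_distrib, Finset.sum_div]
      exact Finset.sum_congr rfl fun x _ => by ring
    rw [h]
    exact div_nonpos_of_nonpos_of_nonneg (by linarith [hgK v hv]) hM.le

/-- A distribution on which the quadratic score of every forecasting tree is at most its expected
number of queries times `O(1 / R(f))`. -/
theorem exists_hard_distribution {ι : Type} {X : Set (ι → Bool)} [Fintype X] (f : X → Bool) {β : ℝ}
    (hf : 0 < randComplexityOfFun f (2 / 3)) (hβ : 262 < β * randComplexityOfFun f (2 / 3)) :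
    ∃ μ : X → ℝ, (∀ x, 0 ≤ μ x) ∧ ∑ x, μ x = 1 ∧
      ∀ D : DecisionTree ι (Set.Icc (-1 : ℝ) 1),
        ∑ x : X, μ x * forecastPayoff β D x (boolSign (f x)) ≤ 0 := by
  have hR : (0 : ℝ) < randComplexityOfFun f (2 / 3) := by exact_mod_cast hf
  have hβ0 : 0 < β := by
    by_contra! h
    nlinarith
  have h5 : β / 2 * ⌊2 / β⌋₊ ≤ 1 := by
    have := Nat.floor_le (show 0 ≤ 2 / β by positivity)
    rw [le_div_iff₀ hβ0] at this
    linarith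
  obtain ⟨μ, hμ0, hμ1, hμ⟩ := exists_weights_nonpos_of_convex
    (K := convexHull ℝ (payoffVectors f (β / 2) ⌊2 / β⌋₊)) (convex_convexHull ℝ _)
    ⟨_, subset_convexHull _ _ ⟨.leaf zeroForecast, by simp [DecisionTree.depth], rfl⟩⟩ (by
      intro v hv hpos
      obtain ⟨ε, hε, hvε⟩ : ∃ ε > 0, ∀ x, ε ≤ v x := by
        rcases isEmpty_or_nonempty X with h | h
        · exact ⟨1, one_pos, fun x => h.elim x⟩
        · obtain ⟨x₀, hx₀⟩ := Finite.exists_min v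
          exact ⟨v x₀, hpos x₀, hx₀⟩
      -- A positive payoff everywhere would give complexity at most `r`, one less than its value.
      -- Truncation halves the price, hence `262 = 2 · 131`.
      obtain ⟨r, hr⟩ : ∃ r, randComplexityOfFun f (2 / 3) = r + 1 :=
        ⟨_, (Nat.succ_pred_eq_of_pos hf).symm⟩
      have hle := randComplexityOfFun_le_of_payoff (r := r) (half_pos hβ0) h5 hε hv hvε (by
        rw [hr] at hβ
        push_cast at hβ
        linarith)
      omega)
  refine ⟨μ, hμ0, hμ1, fun D => ?_⟩
  refine le_trans (Finset.sum_le_sum fun x _ => mul_le_mul_of_nonneg_left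
    (forecastPayoff_le_truncate hβ0 D x (boolSign_sq _)) (hμ0 x)) ?_
  exact hμ _ (subset_convexHull _ _ ⟨_, D.depth_truncate_le _ _, rfl⟩)

end HardDistribution

/-! ### The potential of a single coordinate -/

section Potential

variable {ι : Type} [Fintype ι] [DecidableEq ι]

/-- The part of the weight `w` on the inputs whose bit `i` is `b`. -/
def restrictWeight (w : (ι → Bool) → ℝ) (i : ι) (b : Bool) : (ι → Bool) → ℝ :=
  fun x => if x i = b then w x else 0

/-- The largest payoff of a forecasting tree against the weight `w`. -/
noncomputable def maxPayoff (β : ℝ) (y w : (ι → Bool) → ℝ) : ℝ :=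
  ⨆ D : DecisionTree ι (Set.Icc (-1 : ℝ) 1), ∑ x, w x * forecastPayoff β D x (y x)

omit [Fintype ι] [DecidableEq ι] in
theorem restrictWeight_nonneg {w : (ι → Bool) → ℝ} (hw : 0 ≤ w) (i : ι) (b : Bool) :
    0 ≤ restrictWeight w i b := by
  intro x
  unfold restrictWeight
  split_ifs
  · exact hw x
  · exact le_rfl

theorem sum_restrictWeight (w : (ι → Bool) → ℝ) (i : ι) :
    ∑ x, restrictWeight w i false x + ∑ x, restrictWeight w i true x = ∑ x, w x := by
  rw [← Finset.sum_add_distrib]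
  refine Finset.sum_congr rfl fun x _ => ?_
  cases hx : x i <;> simp [restrictWeight, hx]

variable {β : ℝ} {y w : (ι → Bool) → ℝ}

theorem bddAbove_payoff (hβ : 0 ≤ β) (hy : ∀ x, y x ^ 2 = 1) (hw : 0 ≤ w) :
    BddAbove (Set.range fun D : DecisionTree ι (Set.Icc (-1 : ℝ) 1) =>
      ∑ x, w x * forecastPayoff β D x (y x)) := by
  refine ⟨∑ x, w x, ?_⟩
  rintro _ ⟨D, rfl⟩
  exact Finset.sum_le_sum fun x _ =>
    mul_le_of_le_one_right (hw x) (forecastPayoff_le hβ D x (hy x))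

theorem le_maxPayoff (hβ : 0 ≤ β) (hy : ∀ x, y x ^ 2 = 1) (hw : 0 ≤ w)
    (D : DecisionTree ι (Set.Icc (-1 : ℝ) 1)) :
    ∑ x, w x * forecastPayoff β D x (y x) ≤ maxPayoff β y w :=
  le_ciSup (bddAbove_payoff hβ hy hw) D

theorem maxPayoff_nonneg (hβ : 0 ≤ β) (hy : ∀ x, y x ^ 2 = 1) (hw : 0 ≤ w) :
    0 ≤ maxPayoff β y w := by
  refine le_trans (le_of_eq ?_) (le_maxPayoff hβ hy hw (.leaf zeroForecast))
  simp [forecastPayoff, DecisionTree.eval, DecisionTree.cost, zeroForecast]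

/-- Good trees for the two halves are joined under a query of `i`; the extra query costs `β` on the
whole mass. -/
theorem maxPayoff_restrictWeight_add_le (hβ : 0 ≤ β) (hy : ∀ x, y x ^ 2 = 1) (hw : 0 ≤ w) (i : ι) :
    maxPayoff β y (restrictWeight w i false) + maxPayoff β y (restrictWeight w i true) ≤
      maxPayoff β y w + β * ∑ x, w x := by
  have : Nonempty (DecisionTree ι (Set.Icc (-1 : ℝ) 1)) := ⟨.leaf zeroForecast⟩
  rw [← le_sub_iff_add_le]
  refine ciSup_le fun D₀ => ?_
  rw [le_sub_comm]
  refine ciSup_le fun D₁ => ?_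
  have h := le_maxPayoff hβ hy hw (.query i D₀ D₁)
  have hsum : ∑ x, w x * forecastPayoff β (.query i D₀ D₁) x (y x) + β * ∑ x, w x =
      ∑ x, restrictWeight w i false x * forecastPayoff β D₀ x (y x) +
        ∑ x, restrictWeight w i true x * forecastPayoff β D₁ x (y x) := by
    rw [Finset.mul_sum, ← Finset.sum_add_distrib, ← Finset.sum_add_distrib]
    refine Finset.sum_congr rfl fun x _ => ?_
    cases hx : x i <;>
      simp [restrictWeight, forecastPayoff, DecisionTree.eval, DecisionTree.cost, hx] <;> ring
  linarith

/-- The potential of a weight: its mass plus the largest payoff against it. -/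
noncomputable def potential (β : ℝ) (y w : (ι → Bool) → ℝ) : ℝ :=
  ∑ x, w x + maxPayoff β y w

theorem sum_le_potential (hβ : 0 ≤ β) (hy : ∀ x, y x ^ 2 = 1) (hw : 0 ≤ w) :
    ∑ x, w x ≤ potential β y w :=
  le_add_of_nonneg_right (maxPayoff_nonneg hβ hy hw)

theorem potential_nonneg (hβ : 0 ≤ β) (hy : ∀ x, y x ^ 2 = 1) (hw : 0 ≤ w) :
    0 ≤ potential β y w :=
  (Finset.sum_nonneg fun x _ => hw x).trans (sum_le_potential hβ hy hw)

/-- Including the mass in the potential turns the additive loss `β · mass` into a factor `1 + β`,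
which is what survives taking products over coordinates. -/
theorem potential_restrictWeight_add_le (hβ : 0 ≤ β) (hy : ∀ x, y x ^ 2 = 1) (hw : 0 ≤ w) (i : ι) :
    potential β y (restrictWeight w i false) + potential β y (restrictWeight w i true) ≤
      (1 + β) * potential β y w := by
  have h₁ := maxPayoff_restrictWeight_add_le hβ hy hw i
  have h₂ := sum_restrictWeight w i
  have h₃ := mul_nonneg hβ (maxPayoff_nonneg hβ hy hw)
  unfold potential
  linarith

/-- The mean sign `s / M` is the best forecast without queries, and its payoff is `s² / M`. -/
theorem sum_add_sq_div_le_potential (hβ : 0 ≤ β) (hy : ∀ x, y x ^ 2 = 1) (hw : 0 ≤ w) :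
    ∑ x, w x + (∑ x, w x * y x) ^ 2 / ∑ x, w x ≤ potential β y w := by
  set M := ∑ x, w x with hM
  set s := ∑ x, w x * y x with hs
  have hyb : ∀ x, -1 ≤ y x ∧ y x ≤ 1 := fun x => by
    have := hy x
    constructor <;> nlinarith
  have hs1 : s ≤ M := Finset.sum_le_sum fun x _ => mul_le_of_le_one_right (hw x) (hyb x).2
  have hs2 : -M ≤ s := by
    rw [hM, ← Finset.sum_neg_distrib]
    exact Finset.sum_le_sum fun x _ => by
      have := mul_le_mul_of_nonneg_left (hyb x).1 (hw x)
      simpa using this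
  have hM0 : 0 ≤ M := Finset.sum_nonneg fun x _ => hw x
  refine add_le_add_right ?_ M
  rcases hM0.eq_or_lt with h0 | hpos
  · rw [← h0, div_zero]
    exact maxPayoff_nonneg hβ hy hw
  · have ha : s / M ∈ Set.Icc (-1 : ℝ) 1 :=
      ⟨by rw [le_div_iff₀ hpos]; linarith, by rw [div_le_iff₀ hpos]; linarith⟩
    refine le_trans (le_of_eq ?_) (le_maxPayoff hβ hy hw (.leaf ⟨s / M, ha⟩))
    have h : ∀ a : Set.Icc (-1 : ℝ) 1, ∑ x, w x * forecastPayoff β (.leaf a) x (y x) =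
        2 * a.1 * s - a.1 ^ 2 * M := by
      intro a
      rw [hs, hM, Finset.mul_sum, Finset.mul_sum, ← Finset.sum_sub_distrib]
      refine Finset.sum_congr rfl fun x _ => ?_
      simp only [forecastPayoff, DecisionTree.eval, DecisionTree.cost]
      push_cast
      ring
    rw [h]
    field_simp
    ring

end Potential

/-! ### List decoding for products of weights -/

section ListDecoding

variable {κ ι : Type} [Fintype κ] [DecidableEq κ] [Fintype ι] [DecidableEq ι]

/-- The weight of a tuple of inputs under the product of the weights `w k`. -/
def prodWeight (w : κ → (ι → Bool) → ℝ) (x : κ × ι → Bool) : ℝ :=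
  ∏ k, w k fun j => x (k, j)

omit [DecidableEq κ] [Fintype ι] [DecidableEq ι] in
theorem prodWeight_nonneg {w : κ → (ι → Bool) → ℝ} (hw : ∀ k, 0 ≤ w k) (x : κ × ι → Bool) :
    0 ≤ prodWeight w x :=
  Finset.prod_nonneg fun k _ => hw k _

theorem sum_prodWeight_mul (w : κ → (ι → Bool) → ℝ) (g : κ → (ι → Bool) → ℝ) :
    ∑ x : κ × ι → Bool, prodWeight w x * ∏ k, g k (fun j => x (k, j)) =
      ∏ k, ∑ x, w k x * g k x := by
  rw [Finset.prod_univ_sum, Fintype.piFinset_univ]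
  refine Fintype.sum_equiv (Equiv.curry κ ι Bool) _ _ fun x => ?_
  rw [prodWeight, ← Finset.prod_mul_distrib]
  rfl

theorem sum_prodWeight (w : κ → (ι → Bool) → ℝ) :
    ∑ x : κ × ι → Bool, prodWeight w x = ∏ k, ∑ x, w k x := by
  simpa using sum_prodWeight_mul w fun _ _ => 1

omit [Fintype ι] [DecidableEq ι] in
theorem prodWeight_update_restrictWeight (w : κ → (ι → Bool) → ℝ) (k : κ) (i : ι) (b : Bool)
    (x : κ × ι → Bool) :
    prodWeight (Function.update w k (restrictWeight (w k) i b)) x =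
      if x (k, i) = b then prodWeight w x else 0 := by
  unfold prodWeight
  split_ifs with h
  · refine Finset.prod_congr rfl fun l _ => ?_
    by_cases hl : l = k
    · subst hl; simp [restrictWeight, h]
    · simp [hl]
  · exact Finset.prod_eq_zero (Finset.mem_univ k) (by simp [restrictWeight, h])

omit [Fintype ι] [DecidableEq ι] in
/-- The sum over a query of a product functional changes only the factor that was queried. -/
theorem prod_update_add_prod_update (w : κ → (ι → Bool) → ℝ) (φ : ((ι → Bool) → ℝ) → ℝ) (k : κ)
    (u₀ u₁ : (ι → Bool) → ℝ) :
    ∏ l, φ (Function.update w k u₀ l) + ∏ l, φ (Function.update w k u₁ l) =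
      (φ u₀ + φ u₁) * ∏ l ∈ Finset.univ.erase k, φ (w l) := by
  have h : ∀ u, ∏ l, φ (Function.update w k u l) =
      φ u * ∏ l ∈ Finset.univ.erase k, φ (w l) := by
    intro u
    rw [← Finset.mul_prod_erase _ _ (Finset.mem_univ k), Function.update_self]
    congr 1
    refine Finset.prod_congr rfl fun l hl => ?_
    rw [Function.update_of_ne (Finset.ne_of_mem_erase hl)]
  rw [h, h, add_mul]

/-- The mass of the inputs with label `b`. -/
noncomputable def labelMass (F : (ι → Bool) → Bool) (w : (ι → Bool) → ℝ) (b : Bool) : ℝ :=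
  ∑ x, w x * if F x = b then 1 else 0

theorem labelMass_nonneg (F : (ι → Bool) → Bool) {w : (ι → Bool) → ℝ} (hw : 0 ≤ w) (b : Bool) :
    0 ≤ labelMass F w b :=
  Finset.sum_nonneg fun x _ => mul_nonneg (hw x) (by split_ifs <;> norm_num)

/-- As a sum over the label `b`, the bound `M + s² / M` multiplies out over the coordinates into a
sum over label vectors. -/
theorem sum_labelMass_sq_div_le_potential {β : ℝ} (hβ : 0 ≤ β) (F : (ι → Bool) → Bool)
    {w : (ι → Bool) → ℝ} (hw : 0 ≤ w) :
    ∑ b, 2 * labelMass F w b ^ 2 / ∑ x, w x ≤ potential β (fun x => boolSign (F x)) w := by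
  refine le_trans (le_of_eq ?_)
    (sum_add_sq_div_le_potential hβ (fun x => boolSign_sq (F x)) hw)
  have h₁ : ∑ x, w x = labelMass F w true + labelMass F w false := by
    simp only [labelMass, ← Finset.sum_add_distrib]
    exact Finset.sum_congr rfl fun x _ => by cases hx : F x <;> simp
  have h₂ : ∑ x, w x * boolSign (F x) = labelMass F w true - labelMass F w false := by
    simp only [labelMass, ← Finset.sum_sub_distrib]
    exact Finset.sum_congr rfl fun x _ => by cases hx : F x <;> simp [boolSign]
  rw [h₂, h₁, Fintype.sum_bool, ← add_div]
  by_cases h : labelMass F w true + labelMass F w false = 0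
  · simp [h]
  · field_simp
    ring

omit [DecidableEq κ] in
-- AM-GM with a free weight `c`: summed over the accepted vectors, the square terms are controlled
-- by the potentials and the constant terms by the number of vectors.
theorem prod_labelMass_le {F : (ι → Bool) → Bool} {w : κ → (ι → Bool) → ℝ}
    (hw : ∀ k, 0 ≤ w k) {c : ℝ} (hc : 0 < c) (v : κ → Bool) :
    ∏ k, labelMass F (w k) (v k) ≤
      (c⁻¹ * ∏ k, (2 * labelMass F (w k) (v k) ^ 2 / ∑ x, w k x) +
        c * (∏ k, ∑ x, w k x) / 2 ^ Fintype.card κ) / 2 := by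
  have hm : ∀ k b, labelMass F (w k) b ≤ ∑ x, w k x := fun k b =>
    Finset.sum_le_sum fun x _ => mul_le_of_le_one_right (hw k x) (by split_ifs <;> norm_num)
  rw [Finset.prod_div_distrib, Finset.prod_mul_distrib, Finset.prod_pow, Finset.prod_const,
    Finset.card_univ]
  have hP0 : 0 ≤ ∏ k, labelMass F (w k) (v k) :=
    Finset.prod_nonneg fun k _ => labelMass_nonneg F (hw k) _
  have hPQ : ∏ k, labelMass F (w k) (v k) ≤ ∏ k, ∑ x, w k x :=
    Finset.prod_le_prod (fun k _ => labelMass_nonneg F (hw k) _) fun k _ => hm k _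
  generalize ∏ k, labelMass F (w k) (v k) = P at *
  generalize ∏ k, ∑ x, w k x = Q at *
  have hN : (0 : ℝ) < 2 ^ Fintype.card κ := by positivity
  generalize (2 : ℝ) ^ Fintype.card κ = N at *
  -- If the total mass vanishes, so does `P`, and the division by zero is harmless.
  rcases (hP0.trans hPQ).eq_or_lt with h0 | hQ
  · have : P = 0 := le_antisymm (by rw [h0]; exact hPQ) hP0
    rw [← h0, this]; simp
  · have key : c⁻¹ * (N * P ^ 2 / Q) + c * Q / N - 2 * P = c⁻¹ * (N / Q) * (P - c * Q / N) ^ 2 := by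
      field_simp
      ring
    have : 0 ≤ c⁻¹ * (N / Q) * (P - c * Q / N) ^ 2 := by positivity
    linarith

/-- List-decoding bound: if each output is accepted for at most a fraction `θ` of the label
vectors, then the discounted weight of the accepted inputs is bounded by the potentials. -/
theorem sum_prodWeight_accepted_le {O : Type} {β : ℝ} (hβ : 0 ≤ β) (F : (ι → Bool) → Bool)
    (Acc : O → Finset (κ → Bool)) {θ : ℝ}
    (hθ : ∀ o, ((Acc o).card : ℝ) ≤ θ * 2 ^ Fintype.card κ) {c : ℝ} (hc : 0 < c)
    (D : DecisionTree (κ × ι) O) (w : κ → (ι → Bool) → ℝ) (hw : ∀ k, 0 ≤ w k) :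
    ∑ x : κ × ι → Bool, prodWeight w x * (((1 + β)⁻¹) ^ D.cost x *
        if (fun k => F fun j => x (k, j)) ∈ Acc (D.eval x) then 1 else 0) ≤
      (c⁻¹ * ∏ k, potential β (fun x => boolSign (F x)) (w k) + c * θ * ∏ k, ∑ x, w k x) / 2 := by
  have hy : ∀ x, boolSign (F x) ^ 2 = 1 := fun x => boolSign_sq _
  induction D generalizing w with
  | leaf o =>
    have hQ : 0 ≤ ∏ k, ∑ x, w k x :=
      Finset.prod_nonneg fun k _ => Finset.sum_nonneg fun x _ => hw k x
    have hN : (0 : ℝ) < 2 ^ Fintype.card κ := by positivity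
    have hind : ∀ x : κ × ι → Bool,
        (if (fun k => F fun j => x (k, j)) ∈ Acc o then (1 : ℝ) else 0) =
          ∑ v ∈ Acc o, ∏ k, if F (fun j => x (k, j)) = v k then 1 else 0 := by
      intro x
      rw [← Finset.sum_ite_eq (Acc o) (fun k => F fun j => x (k, j)) fun _ => (1 : ℝ)]
      refine Finset.sum_congr rfl fun v _ => ?_
      rw [Finset.prod_ite_zero]
      simp [funext_iff]
    have hleaf : ∀ x : κ × ι → Bool,
        ((1 + β)⁻¹) ^ (DecisionTree.leaf o : DecisionTree (κ × ι) O).cost x *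
          (if (fun k => F fun j => x (k, j)) ∈ Acc ((DecisionTree.leaf o).eval x) then (1 : ℝ)
            else 0) = ∑ v ∈ Acc o, ∏ k, if F (fun j => x (k, j)) = v k then 1 else 0 := by
      intro x
      rw [DecisionTree.cost, pow_zero, one_mul]
      exact hind x
    rw [Finset.sum_congr rfl fun x _ => by rw [hleaf x, Finset.mul_sum], Finset.sum_comm]
    calc ∑ v ∈ Acc o, ∑ x : κ × ι → Bool,
          prodWeight w x * ∏ k, (if F (fun j => x (k, j)) = v k then 1 else 0)
        = ∑ v ∈ Acc o, ∏ k, labelMass F (w k) (v k) :=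
          Finset.sum_congr rfl fun v _ =>
            sum_prodWeight_mul w fun k x => if F x = v k then 1 else 0
      _ ≤ ∑ v ∈ Acc o, (c⁻¹ * ∏ k, (2 * labelMass F (w k) (v k) ^ 2 / ∑ x, w k x) +
            c * (∏ k, ∑ x, w k x) / 2 ^ Fintype.card κ) / 2 :=
          Finset.sum_le_sum fun v _ => prod_labelMass_le hw hc v
      _ = (c⁻¹ * ∑ v ∈ Acc o, ∏ k, (2 * labelMass F (w k) (v k) ^ 2 / ∑ x, w k x) +
            (Acc o).card * (c * (∏ k, ∑ x, w k x) / 2 ^ Fintype.card κ)) / 2 := by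
          rw [← Finset.sum_div, Finset.sum_add_distrib, ← Finset.mul_sum, Finset.sum_const,
            nsmul_eq_mul]
      _ ≤ _ := by
          refine div_le_div_of_nonneg_right (add_le_add ?_ ?_) two_pos.le
          · refine mul_le_mul_of_nonneg_left ?_ (inv_nonneg.mpr hc.le)
            calc ∑ v ∈ Acc o, ∏ k, (2 * labelMass F (w k) (v k) ^ 2 / ∑ x, w k x)
                ≤ ∑ v : κ → Bool, ∏ k, (2 * labelMass F (w k) (v k) ^ 2 / ∑ x, w k x) :=
                  Finset.sum_le_sum_of_subset_of_nonneg (Finset.subset_univ _) fun v _ _ =>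
                    Finset.prod_nonneg fun k _ => div_nonneg (by positivity)
                      (Finset.sum_nonneg fun x _ => hw k x)
              _ = ∏ k, ∑ b, 2 * labelMass F (w k) b ^ 2 / ∑ x, w k x := by
                  rw [Finset.prod_univ_sum, Fintype.piFinset_univ]
              _ ≤ _ := Finset.prod_le_prod
                  (fun k _ => Finset.sum_nonneg fun b _ => div_nonneg (by positivity)
                      (Finset.sum_nonneg fun x _ => hw k x))
                  fun k _ => sum_labelMass_sq_div_le_potential hβ F (hw k)
          · have h := mul_le_mul_of_nonneg_right (hθ o)
              (show 0 ≤ c * (∏ k, ∑ x, w k x) / 2 ^ Fintype.card κ by positivity)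
            refine h.trans (le_of_eq ?_)
            field_simp
  | query p t₀ t₁ ih₀ ih₁ =>
    obtain ⟨k, i⟩ := p
    have hup : ∀ b l, 0 ≤ Function.update w k (restrictWeight (w k) i b) l := by
      intro b l
      by_cases hl : l = k
      · subst hl; simpa using restrictWeight_nonneg (hw l) i b
      · simpa [hl] using hw l
    have h₀ := ih₀ _ (hup false)
    have h₁ := ih₁ _ (hup true)
    simp only [prodWeight_update_restrictWeight] at h₀ h₁
    have hsplit : ∑ x : κ × ι → Bool, prodWeight w x *
        (((1 + β)⁻¹) ^ (DecisionTree.query (k, i) t₀ t₁).cost x *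
          if (fun k => F fun j => x (k, j)) ∈ Acc ((DecisionTree.query (k, i) t₀ t₁).eval x)
          then 1 else 0) = (1 + β)⁻¹ *
        (∑ x : κ × ι → Bool, (if x (k, i) = false then prodWeight w x else 0) *
            (((1 + β)⁻¹) ^ t₀.cost x *
              if (fun k => F fun j => x (k, j)) ∈ Acc (t₀.eval x) then 1 else 0) +
          ∑ x : κ × ι → Bool, (if x (k, i) = true then prodWeight w x else 0) *
            (((1 + β)⁻¹) ^ t₁.cost x *
              if (fun k => F fun j => x (k, j)) ∈ Acc (t₁.eval x) then 1 else 0)) := by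
      rw [← Finset.sum_add_distrib, Finset.mul_sum]
      refine Finset.sum_congr rfl fun x _ => ?_
      cases hx : x (k, i) <;>
        simp only [DecisionTree.cost, DecisionTree.eval, hx, pow_succ, if_true, if_false,
          Bool.false_eq_true, reduceCtorEq] <;> ring
    rw [hsplit]
    set y : (ι → Bool) → ℝ := fun x => boolSign (F x) with hydef
    have hpot := prod_update_add_prod_update w (potential β y) k (restrictWeight (w k) i false)
      (restrictWeight (w k) i true)
    have hmass := prod_update_add_prod_update w (fun u => ∑ x, u x) k
      (restrictWeight (w k) i false) (restrictWeight (w k) i true)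
    rw [sum_restrictWeight, Finset.mul_prod_erase _ (fun l => ∑ x, w l x) (Finset.mem_univ k)]
      at hmass
    have hpot' : ∏ l, potential β y (Function.update w k (restrictWeight (w k) i false) l) +
        ∏ l, potential β y (Function.update w k (restrictWeight (w k) i true) l) ≤
          (1 + β) * ∏ l, potential β y (w l) := by
      rw [hpot, ← Finset.mul_prod_erase _ (fun l => potential β y (w l)) (Finset.mem_univ k),
        ← mul_assoc]
      exact mul_le_mul_of_nonneg_right (potential_restrictWeight_add_le hβ hy (hw k) i)
        (Finset.prod_nonneg fun l _ => potential_nonneg hβ hy (hw l))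
    have hQ : 0 ≤ ∏ k, ∑ x, w k x :=
      Finset.prod_nonneg fun k _ => Finset.sum_nonneg fun x _ => hw k x
    -- Any output will do here; one is read off from `t₀`.
    have hθ0 : 0 ≤ θ := by
      by_contra! h
      have h2 : (0 : ℝ) < 2 ^ Fintype.card κ := by positivity
      have h3 := hθ (t₀.eval fun _ => false)
      have h4 : (0 : ℝ) ≤ ((Acc (t₀.eval fun _ => false)).card : ℝ) := Nat.cast_nonneg _
      nlinarith
    rw [inv_mul_le_iff₀ (by linarith)]
    have hc' := mul_le_mul_of_nonneg_left hpot' (inv_nonneg.mpr hc.le)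
    -- The mass term is exactly additive under a query, so the allowed factor `1 + β` leaves this
    -- slack.
    have hcθ : 0 ≤ β * (c * θ * ∏ k, ∑ x, w k x) := by positivity
    have hmass' := congrArg (fun t => c * θ * t) hmass
    simp only [mul_add] at hmass'
    refine (add_le_add h₀ h₁).trans ?_
    linarith

end ListDecoding

/-! ### From randomized algorithms to a single tree -/

section RandomizedAverage

/-- Under any distribution on the domain some tree in the support of a randomized algorithm does
at least as well as the algorithm does in the worst case. -/
theorem exists_tree_le_sum_of_computes {ι O : Type} [Fintype ι] [DecidableEq ι]
    {X : Set (ι → Bool)} (R : RandomizedAlgorithm ι O) {rel : X → Set O} {γ : ℝ}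
    (hR : R.Computes rel γ) {p : (ι → Bool) → ℝ} (hp0 : ∀ x, 0 ≤ p x) (hp1 : ∑ x, p x = 1)
    {S : (ι → Bool) → Set O} (hS : ∀ x, p x ≠ 0 → ∃ h : x ∈ X, rel ⟨x, h⟩ ⊆ S x) :
    ∃ D ∈ R.support, γ ≤ ∑ x, p x * (S x).indicator 1 (D.eval x) := by
  classical
  by_contra! hlt
  have hsucc : ∀ x : ι → Bool, HasSum (fun D => (R D).toReal * (S x).indicator 1 (D.eval x))
      (R.successProb x (S x)) := by
    intro x
    have h : R.successProb x (S x) =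
        ∑' D, (R D).toReal * (S x).indicator (1 : O → ℝ) (D.eval x) := by
      rw [RandomizedAlgorithm.successProb, PMF.toOuterMeasure_apply, ENNReal.tsum_toReal_eq]
      · refine tsum_congr fun D => ?_
        by_cases hD : D.eval x ∈ S x <;> simp [Set.indicator, hD]
      · intro D
        by_cases hD : D.eval x ∈ S x <;> simp [Set.indicator, hD, R.apply_ne_top]
    rw [h]
    refine Summable.hasSum ?_
    refine Summable.of_nonneg_of_le (fun D => ?_) (fun D => ?_)
      (ENNReal.summable_toReal R.tsum_coe_ne_top)
    · exact mul_nonneg ENNReal.toReal_nonneg (Set.indicator_nonneg (fun _ _ => zero_le_one) _)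
    · exact mul_le_of_le_one_right ENNReal.toReal_nonneg
        (Set.indicator_le_self' (fun _ _ => zero_le_one) _)
  have hone : HasSum (fun D => (R D).toReal) 1 := by
    have h := ENNReal.hasSum_toReal R.tsum_coe_ne_top
    rwa [← ENNReal.tsum_toReal_eq R.apply_ne_top, R.tsum_coe, ENNReal.toReal_one] at h
  have hlow : γ ≤ ∑ x, p x * R.successProb x (S x) := by
    calc γ = ∑ x, p x * γ := by rw [← Finset.sum_mul, hp1, one_mul]
      _ ≤ _ := Finset.sum_le_sum fun x _ => by
        by_cases hx : p x = 0
        · simp [hx]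
        · obtain ⟨hxX, hsub⟩ := hS x hx
          refine mul_le_mul_of_nonneg_left ((hR ⟨x, hxX⟩).trans ?_) (hp0 x)
          refine ENNReal.toReal_mono ?_ (R.toOuterMeasure.mono fun D hD => hsub hD)
          rw [PMF.toOuterMeasure_apply]
          refine ne_top_of_le_ne_top R.tsum_coe_ne_top (ENNReal.tsum_le_tsum fun D => ?_)
          exact Set.indicator_le_self _ _ _
  have htot : HasSum (fun D => (R D).toReal * ∑ x, p x * (S x).indicator 1 (D.eval x))
      (∑ x, p x * R.successProb x (S x)) := by
    have h := hasSum_sum fun x (_ : x ∈ Finset.univ) => (hsucc x).mul_left (p x)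
    have hcomm : (fun D => (R D).toReal * ∑ x, p x * (S x).indicator 1 (D.eval x)) =
        fun D => ∑ x, p x * ((R D).toReal * (S x).indicator (1 : O → ℝ) (D.eval x)) := by
      ext D
      rw [Finset.mul_sum]
      exact Finset.sum_congr rfl fun x _ => by ring
    rw [hcomm]
    exact h
  obtain ⟨D₀, hD₀⟩ := R.support_nonempty
  have hcontra : ∑ x, p x * R.successProb x (S x) < 1 * γ := by
    -- The support may be infinite, so strictness of the average is drawn from one tree of positive
    -- probability.
    refine hasSum_lt (i := D₀) (fun D => ?_) ?_ htot (hone.mul_right γ)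
    · by_cases hD : D ∈ R.support
      · exact mul_le_mul_of_nonneg_left (hlt D hD).le ENNReal.toReal_nonneg
      · rw [PMF.mem_support_iff, not_not] at hD
        simp [hD]
    · refine mul_lt_mul_of_pos_left (hlt D₀ hD₀) (ENNReal.toReal_pos ?_ (R.apply_ne_top _))
      exact (PMF.mem_support_iff _ _).mp hD₀
  linarith

end RandomizedAverage

/-! ### Threshold relations and the direct product bound -/

section Threshold

theorem card_filter_card_eq_choose (n j : ℕ) (z : Fin n → Bool) :
    (Finset.univ.filter fun y : Fin n → Bool =>
      (Finset.univ.filter fun i => y i ≠ z i).card = j).card = n.choose j := by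
  have h : n.choose j = (Finset.powersetCard j (Finset.univ : Finset (Fin n))).card := by
    simp [Finset.card_powersetCard]
  rw [h]
  refine Finset.card_bij' (fun y _ => Finset.univ.filter fun i => y i ≠ z i)
    (fun s _ i => if i ∈ s then !z i else z i) ?_ ?_ ?_ ?_
  · intro y hy
    simpa [Finset.mem_powersetCard] using hy
  · intro s hs
    rw [Finset.mem_powersetCard] at hs
    simp only [Finset.mem_filter, Finset.mem_univ, true_and]
    rw [← hs.2]
    congr 1
    ext i
    by_cases hi : i ∈ s <;> simp [hi]
  · intro y _
    ext i
    cases hy : y i <;> cases hz : z i <;> simp [hy, hz]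
  · intro s _
    ext i
    by_cases hi : i ∈ s <;> simp [hi]

/-- The number of vectors that agree with `z` in at least `k` places. -/
theorem card_filter_mem_Thr (n k : ℕ) (hk : k ≤ n) (z : Fin n → Bool) :
    (Finset.univ.filter fun y : Fin n → Bool =>
      k ≤ (Finset.univ.filter fun i => y i = z i).card).card =
      ∑ j ∈ Finset.range (n - k + 1), n.choose j := by
  have hcompl : ∀ y : Fin n → Bool, (Finset.univ.filter fun i => y i = z i).card +
      (Finset.univ.filter fun i => y i ≠ z i).card = n := by
    intro y
    rw [Finset.card_filter_add_card_filter_not, Finset.card_univ, Fintype.card_fin]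
  rw [Finset.card_eq_sum_card_fiberwise (t := Finset.range (n - k + 1))
    (f := fun y => (Finset.univ.filter fun i => y i ≠ z i).card)]
  · refine Finset.sum_congr rfl fun j hj => ?_
    rw [← card_filter_card_eq_choose n j z, Finset.filter_filter]
    congr 1
    ext y
    have := hcompl y
    have := Finset.mem_range.mp hj
    simp only [Finset.mem_filter, Finset.mem_univ, true_and]
    omega
  · intro y hy
    have := hcompl y
    simp only [Finset.coe_filter, Finset.mem_univ, true_and, Set.mem_ofPred_eq] at hy
    simp only [Finset.coe_range, Set.mem_Iio]
    omega

theorem sum_choose_pos (n k : ℕ) :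
    (0 : ℝ) < ∑ i ∈ Finset.range (n - k + 1), (n.choose i : ℝ) := by
  refine Finset.sum_pos' (fun i _ => Nat.cast_nonneg _) ⟨0, by simp, by simp⟩

theorem two_rpow_neg_tau (n k : ℕ) :
    (2 : ℝ) ^ (-tau n k) = (∑ i ∈ Finset.range (n - k + 1), (n.choose i : ℝ)) / 2 ^ n := by
  have h := sum_choose_pos n k
  rw [tau, ← Real.logb_inv, inv_div, Real.rpow_logb two_pos (by norm_num) (by positivity)]

/-- The direct product bound behind the theorem: `q` queries on `n` independent inputs from a
distribution on which forecasts are worth at most `β` per query succeed with probability at most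
`(1 + β)^q 2^{-τ/2}`. -/
theorem sum_prodWeight_mem_Thr_le {m n k q : ℕ} (hk : k ≤ n) {β : ℝ} (hβ : 0 ≤ β)
    (F : (Fin m → Bool) → Bool) {μ : (Fin m → Bool) → ℝ} (hμ : 0 ≤ μ) (hμ1 : ∑ x, μ x = 1)
    (hscore : ∀ D : DecisionTree (Fin m) (Set.Icc (-1 : ℝ) 1),
      ∑ x, μ x * forecastPayoff β D x (boolSign (F x)) ≤ 0)
    (D : DecisionTree (Fin n × Fin m) (Fin n → Bool))
    (hq : ∀ x, prodWeight (fun _ : Fin n => μ) x ≠ 0 → D.cost x ≤ q) :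
    ∑ x, prodWeight (fun _ : Fin n => μ) x *
        (Thr n k fun i => F fun j => x (i, j)).indicator 1 (D.eval x) ≤
      (1 + β) ^ q * 2 ^ (-tau n k / 2) := by
  classical
  -- With `θ = 2^{-τ}` this choice gives both AM-GM terms the same bound `2^{-τ/2}`.
  set c : ℝ := 2 ^ (tau n k / 2) with hc
  have hc0 : 0 < c := by positivity
  have hbound := sum_prodWeight_accepted_le hβ F
    (fun z : Fin n → Bool => Finset.univ.filter fun y : Fin n → Bool =>
      k ≤ (Finset.univ.filter fun i => y i = z i).card)
    (θ := 2 ^ (-tau n k)) (fun z => by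
      rw [card_filter_mem_Thr n k hk z, two_rpow_neg_tau, Fintype.card_fin,
        div_mul_cancel₀ _ (by positivity)]
      push_cast
      exact le_rfl) hc0 D (fun _ => μ) (fun _ => hμ)
  have : Nonempty (DecisionTree (Fin m) (Set.Icc (-1 : ℝ) 1)) := ⟨.leaf zeroForecast⟩
  have hpot : potential β (fun x => boolSign (F x)) μ ≤ 1 := by
    have h : maxPayoff β (fun x => boolSign (F x)) μ ≤ 0 := ciSup_le hscore
    rw [potential, hμ1]
    linarith
  have hpot0 := potential_nonneg hβ (fun x => boolSign_sq (F x)) hμ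
  have hpow : ∏ _k : Fin n, potential β (fun x => boolSign (F x)) μ ≤ 1 :=
    Finset.prod_le_one (fun _ _ => hpot0) fun _ _ => hpot
  have hci : c⁻¹ = 2 ^ (-tau n k / 2) := by
    rw [hc, neg_div, Real.rpow_neg two_pos.le]
  have hcm : c * 2 ^ (-tau n k) = 2 ^ (-tau n k / 2) := by
    rw [hc, ← Real.rpow_add two_pos]
    congr 1
    ring
  have hrhs : (c⁻¹ * ∏ _k : Fin n, potential β (fun x => boolSign (F x)) μ +
      c * 2 ^ (-tau n k) * ∏ _k : Fin n, ∑ x, μ x) / 2 ≤ 2 ^ (-tau n k / 2) := by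
    have h := mul_le_mul_of_nonneg_left hpow (inv_nonneg.mpr hc0.le)
    rw [hμ1, Finset.prod_const_one, mul_one, hcm]
    rw [mul_one] at h
    linarith
  refine le_trans ?_ (mul_le_mul_of_nonneg_left (hbound.trans hrhs) (by positivity))
  rw [Finset.mul_sum]
  refine Finset.sum_le_sum fun x _ => ?_
  by_cases hx : prodWeight (fun _ : Fin n => μ) x = 0
  · simp [hx]
  have hmem : D.eval x ∈ Thr n k (fun i => F fun j => x (i, j)) ↔
      (fun i => F fun j => x (i, j)) ∈ Finset.univ.filter fun y : Fin n → Bool =>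
        k ≤ (Finset.univ.filter fun i => y i = D.eval x i).card := by
    simp [Thr]
  by_cases hD : D.eval x ∈ Thr n k (fun i => F fun j => x (i, j))
  · rw [if_pos (hmem.mp hD), Set.indicator_of_mem hD]
    simp only [Pi.one_apply, mul_one]
    rw [mul_left_comm]
    refine le_mul_of_one_le_right (prodWeight_nonneg (fun _ => hμ) x) ?_
    rw [inv_pow, ← div_eq_mul_inv, one_le_div (by positivity)]
    exact pow_le_pow_right₀ (by linarith) (hq x hx)
  · rw [if_neg (fun h => hD (hmem.mpr h)), Set.indicator_of_notMem hD]
    simp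

/-- In logarithms: `1/10 - (log 2)/2 < -1/9 ≤ log (9/10)`. -/
theorem exp_tenth_mul_rpow_lt {t : ℝ} (ht : 0 < t) :
    Real.exp (t / 10) * 2 ^ (-t / 2) < (9 / 10 : ℝ) ^ t := by
  have hlog2 := Real.log_two_gt_d9
  have hlog : -(1 / 9 : ℝ) ≤ Real.log (9 / 10) := by
    have h := Real.one_sub_inv_le_log_of_pos (show (0 : ℝ) < 9 / 10 by norm_num)
    norm_num at h ⊢
    linarith
  rw [Real.rpow_def_of_pos two_pos, Real.rpow_def_of_pos (by norm_num), ← Real.exp_add,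
    Real.exp_lt_exp]
  nlinarith

end Threshold

/-! ### The threshold direct product theorem -/

theorem mainTheorem6 :
    ∃ c : ℝ, 1 / 2 < c ∧ c < 1 ∧ ∃ C : ℝ, 0 < C ∧
      ∀ (m : ℕ) (X : Set (Fin m → Bool)) (f : X → Bool) (n k : ℕ), n < 2 * k → k ≤ n →
        ∀ γ : ℝ, c ≤ γ → γ < 1 →
          C * (tau n k * (randComplexityOfFun f (2 / 3) : ℝ)) ≤
            (randQueryComplexity (fun x => Thr n k (productFun f n x)) (γ ^ tau n k) : ℝ) := by
  classical
  refine ⟨9 / 10, by norm_num, by norm_num, 1 / 2630, by norm_num, ?_⟩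
  intro m X f n k _ hk γ hγ hγ1
  by_contra! hlt
  have hT0 : (0 : ℝ) ≤ (randQueryComplexity (fun x => Thr n k (productFun f n x))
    (γ ^ tau n k) : ℝ) := Nat.cast_nonneg _
  -- A violated bound has a positive left-hand side, which excludes `R(f) = 0` and `τ ≤ 0`.
  have hpos : 0 < tau n k * (randComplexityOfFun f (2 / 3) : ℝ) := by linarith
  have hR0 : 0 < randComplexityOfFun f (2 / 3) := by
    refine Nat.pos_of_ne_zero fun h => ?_
    simp [h] at hpos
  have hR : (0 : ℝ) < randComplexityOfFun f (2 / 3) := by exact_mod_cast hR0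
  have hτ : 0 < tau n k := pos_of_mul_pos_left hpos hR.le
  have hγ0 : 0 ≤ γ := by linarith
  obtain ⟨A, hA, hAcost⟩ := randQueryComplexity_attained
    (fun x => Thr n k (productFun f n x)) (γ := γ ^ tau n k)
    (fun x => ⟨productFun f n x, by simpa [Thr] using hk⟩) (Real.rpow_le_one hγ0 hγ1.le hτ.le)
  set T := randQueryComplexity (fun x => Thr n k (productFun f n x)) (γ ^ tau n k) with hT
  set R := randComplexityOfFun f (2 / 3) with hRdef
  -- Any numerator above `262` meets the hypothesis of `exists_hard_distribution`; `2630` is ten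
  -- times this one, so that `T β ≤ τ / 10` below.
  set β : ℝ := 263 / R with hβ
  have hβ0 : 0 < β := by positivity
  have hβR : β * R = 263 := by rw [hβ]; field_simp
  obtain ⟨ν, hν0, hν1, hν⟩ := exists_hard_distribution f (β := β) hR0 (by
    rw [← hRdef, hβR]; norm_num)
  set F : (Fin m → Bool) → Bool := fun x => if h : x ∈ X then f ⟨x, h⟩ else false with hF
  set μ : (Fin m → Bool) → ℝ := fun x => if h : x ∈ X then ν ⟨x, h⟩ else 0 with hμ
  have hμX : ∀ x, μ x ≠ 0 → x ∈ X := fun x hx => by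
    by_contra h
    exact hx (by simp [hμ, h])
  have hμν : ∀ x : X, μ x = ν x := fun x => by simp [hμ]
  have hFf : ∀ x : X, F x = f x := fun x => by simp [hF]
  have hsum : ∀ g : (Fin m → Bool) → ℝ, ∑ x, μ x * g x = ∑ x : X, ν x * g x := by
    intro g
    exact Finset.sum_congr_set X (fun x => μ x * g x) (fun x => ν x * g x)
      (fun x h => by simp [hμ, h]) fun x h => by simp [hμ, h]
  have hμ0 : 0 ≤ μ := fun x => by
    by_cases h : x ∈ X
    · simpa [hμ, h] using hν0 ⟨x, h⟩
    · simp [hμ, h]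
  have hμ1 : ∑ x, μ x = 1 := by simpa [hν1] using hsum fun _ => 1
  have hscore : ∀ D : DecisionTree (Fin m) (Set.Icc (-1 : ℝ) 1),
      ∑ x, μ x * forecastPayoff β D x (boolSign (F x)) ≤ 0 := fun D => by
    rw [hsum]
    simpa only [hFf] using hν D
  have hdom : ∀ x, prodWeight (fun _ : Fin n => μ) x ≠ 0 → x ∈ productDomain X n :=
    fun x hx i => hμX _ fun h => hx (Finset.prod_eq_zero (Finset.mem_univ i) h)
  obtain ⟨D, hD, hγD⟩ := exists_tree_le_sum_of_computes A hA
    (p := prodWeight fun _ : Fin n => μ) (prodWeight_nonneg fun _ => hμ0)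
    (by rw [sum_prodWeight, hμ1, Finset.prod_const_one])
    (S := fun x => Thr n k fun i => F fun j => x (i, j)) (fun x hx => ⟨hdom x hx, by
      have h : productFun f n ⟨x, hdom x hx⟩ = fun i => F fun j => x (i, j) :=
        funext fun i => (hFf _).symm
      rw [h]⟩)
  have hDcost : ∀ x, prodWeight (fun _ : Fin n => μ) x ≠ 0 → D.cost x ≤ T := fun x hx => by
    have h : (D.cost x : ℕ∞) ≤ A.cost (productDomain X n) :=
      (le_iSup₂_of_le x (hdom x hx) (le_iSup₂_of_le D hD le_rfl))
    exact_mod_cast h.trans hAcost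
  have hupper := sum_prodWeight_mem_Thr_le (k := k) hk hβ0.le F hμ0 hμ1 hscore D hDcost
  have hexp : (1 + β) ^ T ≤ Real.exp (tau n k / 10) := by
    calc (1 + β) ^ T ≤ Real.exp β ^ T :=
          pow_le_pow_left₀ (by positivity) (by linarith [Real.add_one_le_exp β]) T
      _ = Real.exp (T * β) := (Real.exp_nat_mul β T).symm
      _ ≤ _ := by
          rw [Real.exp_le_exp]
          have h := mul_le_mul_of_nonneg_right hlt.le hβ0.le
          have h2 : 1 / 2630 * (tau n k * R) * β = tau n k / 10 := by
            rw [show 1 / 2630 * (tau n k * R) * β = 1 / 2630 * tau n k * (β * R) by ring, hβR]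
            ring
          linarith
  have hγτ : (9 / 10 : ℝ) ^ tau n k ≤ γ ^ tau n k :=
    Real.rpow_le_rpow (by norm_num) hγ hτ.le
  have hlast := mul_le_mul_of_nonneg_right hexp
    (show (0 : ℝ) ≤ 2 ^ (-tau n k / 2) by positivity)
  linarith [exp_tenth_mul_rpow_lt hτ]
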